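/- Let $q(x,y)=ax^2+bxy+cy^2+dx+ey+f$ be any real quadratic polynomial on $\mathbb R^2$ (not necessarily convex) and let $P\subset\mathbb R^2$ be a nonempty polyhedral set, that is, a set of the form $\{x : Ax\le b\}$. Write $I_C$ for the indicator function of $C$ ($0$ on $C$, $+\infty$ elsewhere), $g^*(s)=\sup_{x\in\mathbb R^2}(x^Ts-g(x))$ for the conjugate, and $\operatorname{conv} g$ for the closed convex envelope, i.e. the largest lower semicontinuous convex function below $g$. A polynomial $ax^2+bxy+cy^2+dx+ey+f$ with coefficients not all zero and $b^2-4ac=0$ is called parabolic; a parabola is the zero set of a parabolic polynomial, and a parabolic region is the set of solutions of finitely many inequalities $p_i\le 0$ with every $p_i$ parabolic. A convex set $D\subset\mathbb R^2$ written as a finite union $D=\bigcup_k D_k$ of parabolic regions is a parabolic subdivision if for all $j\ne k$ the intersection $D_j\cap D_k$ is empty or contained in a parabola. A function $g:\mathbb R^2\to(-\infty,+\infty]$ is called piecewise quadratic on a parabolic subdivision if its domain $\{g<+\infty\}$ is a parabolic subdivision $\bigcup_k D_k$ such that on each $D_k$ the function $g$ coincides with a polynomial $s_k$ of degree at most two.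 (1) Let $r_1,\dots,r_n$ be real-valued functions and $R_1,\dots,R_n$ subsets of the plane with $$\operatorname{conv}(q+I_P)=\min_{1\le j\le n}(r_j+I_{R_j})$$ (for example, the decomposition of the convex envelope into rational functions, quadratic over linear, on the pieces of a polyhedral subdivision, when there is one). Then the function $\max_{1\le j\le n}(r_j+I_{R_j})^*$ is piecewise quadratic on a parabolic subdivision. (2) The conjugate $[\operatorname{conv}(q+I_P)]^*$ is piecewise quadratic on a parabolic subdivision. -/

import Mathlib

open Classical in
/-- The indicator function `I_C` of a set `C` of the plane: `0` on `C` and `+∞` off `C`. -/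
noncomputable def indicatorFn (C : Set (ℝ × ℝ)) (x : ℝ × ℝ) : EReal :=
  if x ∈ C then 0 else ⊤

/-- The coefficients of a bivariate polynomial of degree at most two,
`a x² + b x y + c y² + d x + e y + f`. -/
structure QuadPoly where
  a : ℝ
  b : ℝ
  c : ℝ
  d : ℝ
  e : ℝ
  f : ℝ

/-- The value of the polynomial at a point of the plane. -/
def QuadPoly.eval (q : QuadPoly) (x : ℝ × ℝ) : ℝ :=
  q.a * x.1 ^ 2 + q.b * (x.1 * x.2) + q.c * x.2 ^ 2 + q.d * x.1 + q.e * x.2 + q.f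

/-- The polynomial is parabolic: its coefficients are not all zero and `b² - 4ac = 0`. -/
def QuadPoly.IsParabolic (q : QuadPoly) : Prop :=
  ¬ (q.a = 0 ∧ q.b = 0 ∧ q.c = 0 ∧ q.d = 0 ∧ q.e = 0 ∧ q.f = 0) ∧
    q.b ^ 2 - 4 * q.a * q.c = 0

/-- A parabola: the zero set of a parabolic polynomial (lines and the empty set are included,
the whole plane is not). -/
def IsParabola (S : Set (ℝ × ℝ)) : Prop :=
  ∃ p : QuadPoly, p.IsParabolic ∧ S = {x | p.eval x = 0}

/-- A parabolic region: the solution set of finitely many parabolic inequalities. -/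
def IsParabolicRegion (S : Set (ℝ × ℝ)) : Prop :=
  ∃ (k : ℕ) (p : Fin k → QuadPoly), (∀ i, (p i).IsParabolic) ∧
    S = {x | ∀ i, (p i).eval x ≤ 0}

/-- The convex set `R`, written as the union of the regions `D 0, …, D (n - 1)`, is a parabolic
subdivision. -/
def IsParabolicSubdivision (R : Set (ℝ × ℝ)) {n : ℕ} (D : Fin n → Set (ℝ × ℝ)) : Prop :=
  Convex ℝ R ∧ R = ⋃ k, D k ∧ (∀ k, IsParabolicRegion (D k)) ∧
    ∀ j k, j ≠ k → D j ∩ D k = ∅ ∨ ∃ S, IsParabola S ∧ D j ∩ D k ⊆ S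

/-- The domain of an extended-real-valued function: the set where it is less than `+∞`. -/
def effDom (g : ℝ × ℝ → EReal) : Set (ℝ × ℝ) := {x | g x < ⊤}

/-- The domain of `g` is a parabolic subdivision such that `g` coincides on each of its regions
with a polynomial of degree at most two. -/
def IsPiecewiseQuadraticOnParabolicSubdivision (g : ℝ × ℝ → EReal) : Prop :=
  ∃ (n : ℕ) (D : Fin n → Set (ℝ × ℝ)) (s : Fin n → QuadPoly),
    IsParabolicSubdivision (effDom g) D ∧
      ∀ k, ∀ x ∈ D k, g x = (((s k).eval x : ℝ) : EReal)

/-- A polyhedral set: the solution set of finitely many affine inequalities `A x ≤ b`. -/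
def IsPolyhedralSet (P : Set (ℝ × ℝ)) : Prop :=
  ∃ (m : ℕ) (α β γ : Fin m → ℝ), P = {x | ∀ i, α i * x.1 + β i * x.2 ≤ γ i}

/-- Convexity of an extended-real-valued function: its epigraph is convex. -/
def IsConvexFn (g : ℝ × ℝ → EReal) : Prop :=
  Convex ℝ {p : (ℝ × ℝ) × ℝ | g p.1 ≤ (p.2 : EReal)}

/-- The closed convex envelope of `f`: the largest lower semicontinuous convex underestimator. -/
noncomputable def convEnvelope (f : ℝ × ℝ → EReal) (x : ℝ × ℝ) : EReal :=
  ⨆ (g : ℝ × ℝ → EReal) (_ : LowerSemicontinuous g ∧ IsConvexFn g ∧ ∀ y, g y ≤ f y), g x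

/-- The Legendre-Fenchel conjugate of `f`. -/
noncomputable def conjugate (f : ℝ × ℝ → EReal) (s : ℝ × ℝ) : EReal :=
  ⨆ x : ℝ × ℝ, ((x.1 * s.1 + x.2 * s.2 : ℝ) : EReal) - f x

/-- The function `r + I_R`. -/
noncomputable def restrictTo (r : ℝ × ℝ → ℝ) (R : Set (ℝ × ℝ)) (x : ℝ × ℝ) : EReal :=
  ((r x : ℝ) : EReal) + indicatorFn R x

/-- `F` is the minimum of the finitely many pieces `r j + I_(R j)`. -/
def IsMinOfPieces (F : ℝ × ℝ → EReal) {n : ℕ} (r : Fin n → ℝ × ℝ → ℝ)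
    (R : Fin n → Set (ℝ × ℝ)) : Prop :=
  ∀ x, F x = ⨅ j, restrictTo (r j) (R j) x

/-! Every affine minorant of a function also minorizes its closed convex envelope, so the envelope
has the same conjugate (`conjugate_convEnvelope`). Conjugation turns a minimum of pieces into a
maximum of conjugates (`conjugate_eq_iSup_of_isMinOfPieces`). Both claims therefore concern the
supremum over `x ∈ P` of `q.payoff s x`.

If the quadratic form is nonpositive in some nonzero direction, the payoff is convex along it. Where
the supremum is finite, it can then be taken over the boundary of `P`, or over a cross-section if
`P` is invariant along that direction (`piecewiseSup_of_form_nonpos`). If the form is positive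
definite, either the unconstrained maximizer lies in `P` or the boundary dominates again
(`piecewiseSup_of_form_pos`). Boundary and cross-section consist of finitely many segments and rays,
on which the supremum is a `pointPoly` or a `linePoly`.

The crux is that two such polynomials can be compared using signs of polynomials with zero
discriminant. Only `linePoly`s of nonparallel lines have a difference of another kind. Based at the
intersection point, that difference is a difference of two squares of affine functions, so it splits
into affine factors (`exists_compare_linePoly`). The sign patterns of the finitely many polynomials
involved cut the domain into the required parabolic regions (`isPiecewiseQuadratic_conjugate`). -/

open Set

/-! ### Degenerate polynomials and candidate maxima -/

namespace QuadPoly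

/-- The discriminant of the quadratic part vanishes; the zero polynomial is allowed. -/
def IsDegenerate (p : QuadPoly) : Prop := p.b ^ 2 - 4 * p.a * p.c = 0

/-- The affine polynomial `u x + v y + w`. -/
def affine (u v w : ℝ) : QuadPoly := ⟨0, 0, 0, u, v, w⟩

def neg (p : QuadPoly) : QuadPoly := ⟨-p.a, -p.b, -p.c, -p.d, -p.e, -p.f⟩

def sub (p r : QuadPoly) : QuadPoly :=
  ⟨p.a - r.a, p.b - r.b, p.c - r.c, p.d - r.d, p.e - r.e, p.f - r.f⟩

/-- The quadratic form of the polynomial. -/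
def form (q : QuadPoly) (d : ℝ × ℝ) : ℝ := q.a * d.1 ^ 2 + q.b * (d.1 * d.2) + q.c * d.2 ^ 2

/-- The directional derivative of the polynomial. -/
def slope (q : QuadPoly) (x d : ℝ × ℝ) : ℝ :=
  (2 * q.a * x.1 + q.b * x.2 + q.d) * d.1 + (q.b * x.1 + 2 * q.c * x.2 + q.e) * d.2

/-- The function whose supremum over `x` is the conjugate at `s`. -/
def payoff (q : QuadPoly) (s x : ℝ × ℝ) : ℝ := x.1 * s.1 + x.2 * s.2 - q.eval x

/-- The derivative of the payoff at `x` in the direction `d`, as a polynomial in `s`. -/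
def slopePoly (q : QuadPoly) (x d : ℝ × ℝ) : QuadPoly := affine d.1 d.2 (-q.slope x d)

/-- The payoff at `v`, as a polynomial in `s`. -/
def pointPoly (q : QuadPoly) (v : ℝ × ℝ) : QuadPoly := affine v.1 v.2 (-q.eval v)

/-- The maximum of the payoff over the line through `p` with direction `d`, as a polynomial in
`s`. -/
noncomputable def linePoly (q : QuadPoly) (p d : ℝ × ℝ) : QuadPoly :=
  ⟨d.1 ^ 2 / (4 * q.form d), 2 * d.1 * d.2 / (4 * q.form d), d.2 ^ 2 / (4 * q.form d),
    p.1 - 2 * d.1 * q.slope p d / (4 * q.form d), p.2 - 2 * d.2 * q.slope p d / (4 * q.form d),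
    q.slope p d ^ 2 / (4 * q.form d) - q.eval p⟩

theorem neg_eval (p : QuadPoly) (s : ℝ × ℝ) : p.neg.eval s = -p.eval s := by
  simp only [neg, eval]; ring

theorem sub_eval (p r : QuadPoly) (s : ℝ × ℝ) : (p.sub r).eval s = p.eval s - r.eval s := by
  simp only [sub, eval]; ring

theorem affine_eval (u v w : ℝ) (s : ℝ × ℝ) : (affine u v w).eval s = u * s.1 + v * s.2 + w := by
  simp only [affine, eval]; ring

theorem affine_isDegenerate (u v w : ℝ) : (affine u v w).IsDegenerate := by
  simp [affine, IsDegenerate]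

theorem pointPoly_eval (q : QuadPoly) (v s : ℝ × ℝ) : (q.pointPoly v).eval s = q.payoff s v := by
  rw [pointPoly, affine_eval, payoff]; ring

theorem linePoly_eval (q : QuadPoly) (p d s : ℝ × ℝ) :
    (q.linePoly p d).eval s = q.payoff s p + (q.slopePoly p d).eval s ^ 2 / (4 * q.form d) := by
  rw [slopePoly, affine_eval, payoff]
  simp only [linePoly, eval]
  ring

theorem payoff_add_smul (q : QuadPoly) (s x d : ℝ × ℝ) (t : ℝ) :
    q.payoff s (x + t • d) =
      q.payoff s x + t * (q.slopePoly x d).eval s - t ^ 2 * q.form d := by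
  rw [slopePoly, affine_eval]
  simp only [payoff, eval, slope, form, Prod.fst_add, Prod.snd_add, Prod.smul_fst, Prod.smul_snd,
    smul_eq_mul]
  ring

theorem slopePoly_add_smul (q : QuadPoly) (s x d : ℝ × ℝ) (t : ℝ) :
    (q.slopePoly (x + t • d) d).eval s = (q.slopePoly x d).eval s - 2 * t * q.form d := by
  simp only [slopePoly, affine_eval, slope, form, Prod.fst_add, Prod.snd_add, Prod.smul_fst,
    Prod.smul_snd, smul_eq_mul]
  ring

/-- The maximum over a line does not depend on its base point; this allows two crossing lines to be
based at their intersection. -/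
theorem linePoly_add_smul (q : QuadPoly) (s p d : ℝ × ℝ) (t : ℝ) (h : 0 < q.form d) :
    (q.linePoly (p + t • d) d).eval s = (q.linePoly p d).eval s := by
  rw [linePoly_eval, linePoly_eval, payoff_add_smul, slopePoly_add_smul]
  field_simp
  ring

/-- Polynomials that occur as suprema of the payoff over points and lines. -/
def IsCandidate (q g : QuadPoly) : Prop :=
  (∃ v, g = q.pointPoly v) ∨ ∃ p d, 0 < q.form d ∧ g = q.linePoly p d

end QuadPoly

/-- Every polynomial of `L` has a constant weak sign on `C`. -/
def Coherent (L : Set QuadPoly) (C : Set (ℝ × ℝ)) : Prop :=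
  ∀ p ∈ L, (∀ s ∈ C, p.eval s ≤ 0) ∨ ∀ s ∈ C, 0 ≤ p.eval s

theorem Coherent.mono {L M : Set QuadPoly} {C : Set (ℝ × ℝ)} (h : Coherent M C) (hLM : L ⊆ M) :
    Coherent L C := fun p hp => h p (hLM hp)

/-! ### Comparison of candidates -/

namespace QuadPoly

theorem exists_compare_of_sub_isDegenerate {g r : QuadPoly} (h : (g.sub r).IsDegenerate) :
    ∃ L : Set QuadPoly, L.Finite ∧ (∀ p ∈ L, p.IsDegenerate) ∧ ∀ C, Coherent L C →
      (∀ s ∈ C, g.eval s ≤ r.eval s) ∨ ∀ s ∈ C, r.eval s ≤ g.eval s := by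
  refine ⟨{g.sub r}, finite_singleton _, by simpa using h, fun C hC => ?_⟩
  refine (hC _ rfl).imp (fun h s hs => ?_) (fun h s hs => ?_) <;>
  · have := h s hs
    rw [sub_eval] at this
    linarith

/-- For parallel lines the difference is itself degenerate. For crossing lines the payoff at the
common point cancels, and what remains is a difference of squares whose two affine factors decide
the comparison. -/
theorem exists_compare_linePoly {q : QuadPoly} {p₁ d₁ p₂ d₂ : ℝ × ℝ} (h₁ : 0 < q.form d₁)
    (h₂ : 0 < q.form d₂) :
    ∃ L : Set QuadPoly, L.Finite ∧ (∀ p ∈ L, p.IsDegenerate) ∧ ∀ C, Coherent L C →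
      (∀ s ∈ C, (q.linePoly p₁ d₁).eval s ≤ (q.linePoly p₂ d₂).eval s) ∨
        ∀ s ∈ C, (q.linePoly p₂ d₂).eval s ≤ (q.linePoly p₁ d₁).eval s := by
  by_cases hdet : d₁.1 * d₂.2 - d₁.2 * d₂.1 = 0
  · apply exists_compare_of_sub_isDegenerate
    -- This fraction is the discriminant of the difference.
    have : (4 * (d₁.1 * d₂.2 - d₁.2 * d₂.1) ^ 2) / (16 * q.form d₁ * q.form d₂) = 0 := by
      rw [hdet]; simp
    rw [IsDegenerate, ← this]
    simp only [sub, linePoly]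
    field_simp
    ring
  · obtain ⟨t₁, t₂, ht⟩ : ∃ t₁ t₂ : ℝ, p₁ + t₁ • d₁ = p₂ + t₂ • d₂ := by
      obtain ⟨δ, hδ⟩ : ∃ δ, δ = d₁.1 * d₂.2 - d₁.2 * d₂.1 := ⟨_, rfl⟩
      rw [← hδ] at hdet
      refine ⟨((p₂.1 - p₁.1) * d₂.2 - (p₂.2 - p₁.2) * d₂.1) / δ,
        ((p₂.1 - p₁.1) * d₁.2 - (p₂.2 - p₁.2) * d₁.1) / δ, ?_⟩
      ext <;> simp only [Prod.fst_add, Prod.snd_add, Prod.smul_fst, Prod.smul_snd, smul_eq_mul] <;>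
        field_simp <;> rw [hδ] <;> ring
    set x := p₁ + t₁ • d₁ with hx
    have e₁ : ∀ s, (q.linePoly p₁ d₁).eval s = (q.linePoly x d₁).eval s := fun s =>
      (linePoly_add_smul q s p₁ d₁ t₁ h₁).symm
    have e₂ : ∀ s, (q.linePoly p₂ d₂).eval s = (q.linePoly x d₂).eval s := fun s => by
      rw [ht]; exact (linePoly_add_smul q s p₂ d₂ t₂ h₂).symm
    clear_value x
    simp only [e₁, e₂, linePoly_eval]
    set r₁ := Real.sqrt (q.form d₁)
    set r₂ := Real.sqrt (q.form d₂)
    have hr₁ : 0 < r₁ := Real.sqrt_pos.2 h₁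
    have hr₂ : 0 < r₂ := Real.sqrt_pos.2 h₂
    have s₁ : q.form d₁ = r₁ ^ 2 := (Real.sq_sqrt h₁.le).symm
    have s₂ : q.form d₂ = r₂ ^ 2 := (Real.sq_sqrt h₂.le).symm
    -- With `ε = ±1` these are the factors of `(r₂ B₁)² - (r₁ B₂)²`, where `Bᵢ` is the slope along
    -- `dᵢ` at `x`.
    let comb (ε : ℝ) : QuadPoly := affine (r₂ * d₁.1 + ε * (r₁ * d₂.1))
      (r₂ * d₁.2 + ε * (r₁ * d₂.2)) (-(r₂ * q.slope x d₁) - ε * (r₁ * q.slope x d₂))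
    have hcomb : ∀ ε s, (comb ε).eval s =
        r₂ * (q.slopePoly x d₁).eval s + ε * (r₁ * (q.slopePoly x d₂).eval s) := by
      intro ε s
      simp only [comb, slopePoly, affine_eval]
      ring
    have key : ∀ s, (q.slopePoly x d₁).eval s ^ 2 / (4 * q.form d₁) -
        (q.slopePoly x d₂).eval s ^ 2 / (4 * q.form d₂) =
        (comb 1).eval s * (comb (-1)).eval s * (1 / (4 * r₁ ^ 2 * r₂ ^ 2)) := by
      intro s
      rw [hcomb, hcomb, s₁, s₂]
      field_simp
      ring
    have hpos : 0 ≤ 1 / (4 * r₁ ^ 2 * r₂ ^ 2) := by positivity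
    have le_of : ∀ s, (comb 1).eval s * (comb (-1)).eval s ≤ 0 →
        q.payoff s x + (q.slopePoly x d₁).eval s ^ 2 / (4 * q.form d₁) ≤
        q.payoff s x + (q.slopePoly x d₂).eval s ^ 2 / (4 * q.form d₂) := fun s hs => by
      have := mul_nonpos_of_nonpos_of_nonneg hs hpos
      linarith [key s]
    have ge_of : ∀ s, 0 ≤ (comb 1).eval s * (comb (-1)).eval s →
        q.payoff s x + (q.slopePoly x d₂).eval s ^ 2 / (4 * q.form d₂) ≤
        q.payoff s x + (q.slopePoly x d₁).eval s ^ 2 / (4 * q.form d₁) := fun s hs => by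
      have := mul_nonneg hs hpos
      linarith [key s]
    refine ⟨{comb 1, comb (-1)}, by simp, ?_, fun C hC => ?_⟩
    · rintro p (rfl | rfl) <;> exact affine_isDegenerate _ _ _
    · rcases hC _ (mem_insert _ _) with h | h <;>
        rcases hC _ (mem_insert_of_mem _ rfl) with h' | h'
      · exact Or.inr fun s hs => ge_of s (mul_nonneg_of_nonpos_of_nonpos (h s hs) (h' s hs))
      · exact Or.inl fun s hs => le_of s (mul_nonpos_of_nonpos_of_nonneg (h s hs) (h' s hs))
      · exact Or.inl fun s hs => le_of s (mul_nonpos_of_nonneg_of_nonpos (h s hs) (h' s hs))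
      · exact Or.inr fun s hs => ge_of s (mul_nonneg (h s hs) (h' s hs))

/-- Two candidates are comparable on every set on which finitely many degenerate polynomials
have constant weak signs. -/
theorem IsCandidate.exists_compare {q g r : QuadPoly} (hg : q.IsCandidate g)
    (hr : q.IsCandidate r) :
    ∃ L : Set QuadPoly, L.Finite ∧ (∀ p ∈ L, p.IsDegenerate) ∧ ∀ C, Coherent L C →
      (∀ s ∈ C, g.eval s ≤ r.eval s) ∨ ∀ s ∈ C, r.eval s ≤ g.eval s := by
  obtain ⟨v, rfl⟩ | ⟨p₁, d₁, h₁, rfl⟩ := hg <;> obtain ⟨w, rfl⟩ | ⟨p₂, d₂, h₂, rfl⟩ := hr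
  · apply exists_compare_of_sub_isDegenerate
    simp [IsDegenerate, sub, pointPoly, affine]
  · apply exists_compare_of_sub_isDegenerate
    simp only [IsDegenerate, sub, pointPoly, affine, linePoly]
    ring
  · apply exists_compare_of_sub_isDegenerate
    simp only [IsDegenerate, sub, pointPoly, affine, linePoly]
    ring
  · exact exists_compare_linePoly h₁ h₂

theorem exists_compare_finite {q : QuadPoly} {S T : Set QuadPoly} (hS : S.Finite) (hT : T.Finite)
    (hSq : ∀ g ∈ S, q.IsCandidate g) (hTq : ∀ g ∈ T, q.IsCandidate g) :
    ∃ L : Set QuadPoly, L.Finite ∧ (∀ p ∈ L, p.IsDegenerate) ∧ ∀ C, Coherent L C →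
      ∀ g ∈ S, ∀ r ∈ T,
        (∀ s ∈ C, g.eval s ≤ r.eval s) ∨ ∀ s ∈ C, r.eval s ≤ g.eval s := by
  have : ∀ g r : QuadPoly, ∃ L : Set QuadPoly, L.Finite ∧ (∀ p ∈ L, p.IsDegenerate) ∧
      (q.IsCandidate g → q.IsCandidate r → ∀ C, Coherent L C →
        (∀ s ∈ C, g.eval s ≤ r.eval s) ∨ ∀ s ∈ C, r.eval s ≤ g.eval s) := by
    intro g r
    by_cases h : q.IsCandidate g ∧ q.IsCandidate r
    · obtain ⟨L, h1, h2, h3⟩ := h.1.exists_compare h.2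
      exact ⟨L, h1, h2, fun _ _ => h3⟩
    · exact ⟨∅, finite_empty, by simp, fun h1 h2 => absurd ⟨h1, h2⟩ h⟩
  choose L hfin hdeg hcmp using this
  refine ⟨⋃ g ∈ S, ⋃ r ∈ T, L g r, hS.biUnion fun g _ => hT.biUnion fun r _ => hfin g r, ?_, ?_⟩
  · intro p hp
    simp only [mem_iUnion] at hp
    obtain ⟨g, -, r, -, hp⟩ := hp
    exact hdeg g r p hp
  · intro C hC g hg r hr
    refine hcmp g r (hSq g hg) (hTq r hr) C (hC.mono fun p hp => ?_)
    simp only [mem_iUnion]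
    exact ⟨g, hg, r, hr, hp⟩

/-! ### Piecewise description of suprema -/

/-- The supremum of the payoff over `S` is finite on the solution set of finitely many degenerate
inequalities, and is a polynomial with the property `K` wherever finitely many degenerate
polynomials have constant weak signs. -/
def PiecewiseSup (q : QuadPoly) (K : QuadPoly → Prop) (S : Set (ℝ × ℝ)) : Prop :=
  ∃ D L T : Set QuadPoly, D.Finite ∧ L.Finite ∧ T.Finite ∧ (∀ p ∈ D, p.IsDegenerate) ∧
    (∀ p ∈ L, p.IsDegenerate) ∧ (∀ g ∈ T, K g) ∧
    (∀ s, BddAbove (q.payoff s '' S) ↔ ∀ p ∈ D, p.eval s ≤ 0) ∧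
    ∀ C, Coherent L C → (∀ s ∈ C, BddAbove (q.payoff s '' S)) →
      ∃ g ∈ T, ∀ s ∈ C, IsLUB (q.payoff s '' S) (g.eval s)

/-- The supremum over a union is the larger of the two suprema. Adding the polynomials that compare
the finitely many candidates makes the choice uniform on each coherent set. -/
theorem PiecewiseSup.union {q : QuadPoly} {S S' : Set (ℝ × ℝ)}
    (h : q.PiecewiseSup q.IsCandidate S) (h' : q.PiecewiseSup q.IsCandidate S') :
    q.PiecewiseSup q.IsCandidate (S ∪ S') := by
  obtain ⟨D, L, T, hD, hL, hT, hDd, hLd, hTc, hdom, hsup⟩ := h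
  obtain ⟨D', L', T', hD', hL', hT', hDd', hLd', hTc', hdom', hsup'⟩ := h'
  obtain ⟨M, hM, hMd, hcmp⟩ := exists_compare_finite hT hT' hTc hTc'
  refine ⟨D ∪ D', L ∪ L' ∪ M, T ∪ T', hD.union hD', (hL.union hL').union hM, hT.union hT',
    fun p hp => hp.elim (hDd p) (hDd' p),
    fun p hp => hp.elim (fun hp => hp.elim (hLd p) (hLd' p)) (hMd p),
    fun p hp => hp.elim (hTc p) (hTc' p), fun s => ?_, fun C hC hb => ?_⟩
  · rw [image_union, bddAbove_union, hdom, hdom']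
    exact ⟨fun h p hp => hp.elim (h.1 p) (h.2 p),
      fun h => ⟨fun p hp => h p (Or.inl hp), fun p hp => h p (Or.inr hp)⟩⟩
  · simp only [image_union, bddAbove_union] at hb ⊢
    obtain ⟨g, hg, hgs⟩ := hsup C (hC.mono fun p hp => Or.inl (Or.inl hp)) fun s hs => (hb s hs).1
    obtain ⟨r, hr, hrs⟩ := hsup' C (hC.mono fun p hp => Or.inl (Or.inr hp)) fun s hs => (hb s hs).2
    rcases hcmp C (hC.mono fun p hp => Or.inr hp) g hg r hr with hle | hle
    · refine ⟨r, Or.inr hr, fun s hs => ?_⟩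
      have := (hgs s hs).union (hrs s hs)
      rwa [sup_eq_right.2 (hle s hs)] at this
    · refine ⟨g, Or.inl hg, fun s hs => ?_⟩
      have := (hgs s hs).union (hrs s hs)
      rwa [sup_eq_left.2 (hle s hs)] at this

theorem upperBounds_payoff_eq {q : QuadPoly} {S E : Set (ℝ × ℝ)} {s : ℝ × ℝ} (hES : E ⊆ S)
    (h : ∀ x ∈ S, ∃ y ∈ E, q.payoff s x ≤ q.payoff s y) :
    upperBounds (q.payoff s '' S) = upperBounds (q.payoff s '' E) := by
  refine Subset.antisymm (upperBounds_mono_set (image_mono hES)) ?_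
  rintro M hM _ ⟨x, hx, rfl⟩
  obtain ⟨y, hy, hxy⟩ := h x hx
  exact hxy.trans (hM ⟨y, hy, rfl⟩)

/-- A subset that dominates `S` wherever the payoff is bounded on `S` may replace `S`. -/
theorem PiecewiseSup.of_dominating {q : QuadPoly} {K : QuadPoly → Prop} {S E : Set (ℝ × ℝ)}
    {D₀ : Set QuadPoly} (hE : q.PiecewiseSup K E) (hES : E ⊆ S) (hfin : D₀.Finite)
    (hdeg : ∀ p ∈ D₀, p.IsDegenerate)
    (hbdd : ∀ s, BddAbove (q.payoff s '' S) → ∀ p ∈ D₀, p.eval s ≤ 0)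
    (hdom : ∀ s, (∀ p ∈ D₀, p.eval s ≤ 0) → ∀ x ∈ S, ∃ y ∈ E, q.payoff s x ≤ q.payoff s y) :
    q.PiecewiseSup K S := by
  obtain ⟨D, L, T, hD, hL, hT, hDd, hLd, hTc, hd, hsup⟩ := hE
  have hub : ∀ s, (∀ p ∈ D₀, p.eval s ≤ 0) →
      upperBounds (q.payoff s '' S) = upperBounds (q.payoff s '' E) :=
    fun s hs => upperBounds_payoff_eq hES (hdom s hs)
  refine ⟨D₀ ∪ D, L, T, hfin.union hD, hL, hT, fun p hp => hp.elim (hdeg p) (hDd p), hLd, hTc,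
    fun s => ⟨fun h p hp => hp.elim (hbdd s h p)
      ((hd s).1 (h.mono (image_mono hES)) p), fun h => ?_⟩, fun C hC hb => ?_⟩
  · rw [BddAbove, hub s fun p hp => h p (Or.inl hp)]
    exact (hd s).2 fun p hp => h p (Or.inr hp)
  · obtain ⟨g, hg, hgs⟩ := hsup C hC fun s hs => (hb s hs).mono (image_mono hES)
    refine ⟨g, hg, fun s hs => ?_⟩
    rw [IsLUB, hub s (hbdd s (hb s hs))]
    exact hgs s hs

theorem piecewiseSup_of_not_bddAbove {q : QuadPoly} {S : Set (ℝ × ℝ)}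
    (h : ∀ s, ¬ BddAbove (q.payoff s '' S)) : q.PiecewiseSup q.IsCandidate S := by
  -- The inequality `1 ≤ 0` encodes the empty domain; the candidate is arbitrary.
  refine ⟨{affine 0 0 1}, ∅, {q.pointPoly 0}, by simp, by simp, by simp, ?_, by simp, ?_, ?_, ?_⟩
  · rintro p rfl; exact affine_isDegenerate _ _ _
  · rintro p rfl; exact Or.inl ⟨0, rfl⟩
  · intro s
    simp only [h s, false_iff, mem_singleton_iff, forall_eq, affine_eval]
    norm_num
  · exact fun C _ hb => ⟨_, rfl, fun s hs => absurd (hb s hs) (h s)⟩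

theorem piecewiseSup_singleton (q : QuadPoly) (v : ℝ × ℝ) :
    q.PiecewiseSup q.IsCandidate {v} := by
  refine ⟨∅, ∅, {q.pointPoly v}, by simp, by simp, by simp, by simp, by simp, ?_, ?_, ?_⟩
  · rintro p rfl; exact Or.inl ⟨v, rfl⟩
  · simp
  · refine fun C _ _ => ⟨_, rfl, fun s _ => ?_⟩
    rw [image_singleton, pointPoly_eval]
    exact isLUB_singleton

/-! ### Segments and rays -/

/-- The segment or ray consisting of the points `p + t d` with `t ∈ I`. -/
def track (p d : ℝ × ℝ) (I : Set ℝ) : Set (ℝ × ℝ) := (fun t : ℝ => p + t • d) '' I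

theorem isLUB_payoff_of_mem {q : QuadPoly} {S : Set (ℝ × ℝ)} {s y : ℝ × ℝ} {r : ℝ} (hy : y ∈ S)
    (hr : r = q.payoff s y) (h : ∀ x ∈ S, q.payoff s x ≤ q.payoff s y) :
    IsLUB (q.payoff s '' S) r := by
  subst hr
  exact IsGreatest.isLUB ⟨⟨y, hy, rfl⟩, by rintro _ ⟨x, hx, rfl⟩; exact h x hx⟩

theorem payoff_add_smul_le_vertex {q : QuadPoly} {s p d : ℝ × ℝ} (h : 0 < q.form d) (t : ℝ) :
    q.payoff s (p + t • d) ≤ q.payoff s (p + ((q.slopePoly p d).eval s / (2 * q.form d)) • d) := by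
  rw [payoff_add_smul, payoff_add_smul]
  have : (q.payoff s p + (q.slopePoly p d).eval s / (2 * q.form d) * (q.slopePoly p d).eval s -
      ((q.slopePoly p d).eval s / (2 * q.form d)) ^ 2 * q.form d) -
      (q.payoff s p + t * (q.slopePoly p d).eval s - t ^ 2 * q.form d) =
      q.form d * (t - (q.slopePoly p d).eval s / (2 * q.form d)) ^ 2 := by
    field_simp
    ring
  have := mul_nonneg h.le (sq_nonneg (t - (q.slopePoly p d).eval s / (2 * q.form d)))
  linarith

theorem linePoly_eval_eq_payoff {q : QuadPoly} {s p d : ℝ × ℝ} (h : 0 < q.form d) :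
    (q.linePoly p d).eval s =
      q.payoff s (p + ((q.slopePoly p d).eval s / (2 * q.form d)) • d) := by
  rw [payoff_add_smul, linePoly_eval]
  field_simp
  ring

/-- If the form is nonpositive along `d`, the payoff is convex there and the endpoints dominate.
Otherwise it is a concave parabola, and the slopes at the two ends tell whether its vertex lies
before, on or after the segment. -/
theorem piecewiseSup_segment (q : QuadPoly) (p d : ℝ × ℝ) :
    q.PiecewiseSup q.IsCandidate (track p d (Icc 0 1)) := by
  have hp : p ∈ track p d (Icc 0 1) := ⟨0, by simp, by simp⟩
  have hw : p + d ∈ track p d (Icc 0 1) := ⟨1, by simp, by simp⟩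
  have pw : ∀ s, q.payoff s (p + d) = q.payoff s p + (q.slopePoly p d).eval s - q.form d := by
    intro s
    have := q.payoff_add_smul s p d 1
    simpa using this
  rcases le_or_gt (q.form d) 0 with h | h
  · refine ((q.piecewiseSup_singleton p).union (q.piecewiseSup_singleton (p + d))).of_dominating
      (D₀ := ∅) ?_ finite_empty (by simp) (by simp) ?_
    · rintro x (rfl | rfl)
      exacts [hp, hw]
    · rintro s - _ ⟨t, ⟨h0, h1⟩, rfl⟩
      rcases le_total ((q.slopePoly p d).eval s - q.form d) 0 with hB | hB
      · refine ⟨p, Or.inl rfl, ?_⟩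
        simp only [payoff_add_smul]
        nlinarith [mul_nonneg h0 (sub_nonneg.2 h1), mul_nonneg h0 (sub_nonneg.2 hB),
          mul_nonneg (mul_nonneg h0 (sub_nonneg.2 h1)) (neg_nonneg.2 h)]
      · refine ⟨p + d, Or.inr rfl, ?_⟩
        simp only [payoff_add_smul, pw]
        nlinarith [mul_nonneg h0 (sub_nonneg.2 h1), mul_nonneg (sub_nonneg.2 h1) hB,
          mul_nonneg (mul_nonneg h0 (sub_nonneg.2 h1)) (neg_nonneg.2 h)]
  · let B := q.slopePoly p d
    -- `B'` is the slope at the far endpoint `p + d`.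
    let B' := affine d.1 d.2 (-q.slope p d - 2 * q.form d)
    have hB' : ∀ s, B'.eval s = B.eval s - 2 * q.form d := fun s => by
      simp only [B, B', slopePoly, affine_eval]; ring
    refine ⟨∅, {B, B'}, {q.pointPoly p, q.linePoly p d, q.pointPoly (p + d)}, by simp, by simp,
      by simp, by simp, ?_, ?_, ?_, ?_⟩
    · rintro r (rfl | rfl) <;> exact affine_isDegenerate _ _ _
    · rintro r (rfl | rfl | rfl)
      exacts [Or.inl ⟨_, rfl⟩, Or.inr ⟨_, _, h, rfl⟩, Or.inl ⟨_, rfl⟩]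
    · intro s
      simp only [mem_empty_iff_false, false_imp_iff, implies_true, iff_true]
      refine ⟨(q.linePoly p d).eval s, ?_⟩
      rintro _ ⟨_, ⟨t, -, rfl⟩, rfl⟩
      rw [linePoly_eval_eq_payoff h]
      exact payoff_add_smul_le_vertex h t
    · intro C hC _
      rcases hC B (by simp) with hB | hB
      · refine ⟨q.pointPoly p, by simp, fun s hs => isLUB_payoff_of_mem hp (pointPoly_eval _ _ _) ?_⟩
        rintro _ ⟨t, ⟨h0, h1⟩, rfl⟩
        simp only [payoff_add_smul]
        have := mul_nonpos_of_nonneg_of_nonpos h0 (hB s hs)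
        have := mul_nonneg (sq_nonneg t) h.le
        linarith
      rcases hC B' (by simp) with hB1 | hB1
      · refine ⟨q.linePoly p d, by simp, fun s hs => isLUB_payoff_of_mem
          (y := p + ((q.slopePoly p d).eval s / (2 * q.form d)) • d) ⟨_, ⟨?_, ?_⟩, rfl⟩
          (linePoly_eval_eq_payoff h) ?_⟩
        · exact div_nonneg (hB s hs) (by linarith)
        · rw [div_le_one (by linarith)]
          linarith [hB1 s hs, hB' s]
        · rintro _ ⟨t, -, rfl⟩
          exact payoff_add_smul_le_vertex h t
      · refine ⟨q.pointPoly (p + d), by simp, fun s hs =>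
          isLUB_payoff_of_mem hw (pointPoly_eval _ _ _) ?_⟩
        rintro _ ⟨t, ⟨h0, h1⟩, rfl⟩
        simp only [payoff_add_smul, pw]
        have h2 : 2 * q.form d ≤ (q.slopePoly p d).eval s := by linarith [hB1 s hs, hB' s]
        nlinarith [mul_nonneg (sub_nonneg.2 h1) (sub_nonneg.2 h2),
          mul_nonneg (sq_nonneg (1 - t)) h.le]

theorem not_bddAbove_of_ray {q : QuadPoly} {S : Set (ℝ × ℝ)} {s p d : ℝ × ℝ}
    (hS : ∀ t : ℝ, 0 ≤ t → p + t • d ∈ S)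
    (h : q.form d < 0 ∨ q.form d ≤ 0 ∧ 0 < (q.slopePoly p d).eval s) :
    ¬ BddAbove (q.payoff s '' S) := by
  rintro ⟨M, hM⟩
  have hb : ∀ t : ℝ, 0 ≤ t →
      q.payoff s p + t * (q.slopePoly p d).eval s - t ^ 2 * q.form d ≤ M := fun t ht => by
    rw [← payoff_add_smul]
    exact hM ⟨_, hS t ht, rfl⟩
  set A := q.payoff s p
  set B := (q.slopePoly p d).eval s
  set c := q.form d
  rcases h with h | ⟨h, hB⟩
  -- The parameter `t` satisfies `t ≥ 1` and makes `t * (-c)` at least `|B| + |M - A| + 1`, so the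
  -- quadratic term beats the linear one and the bound.
  · have h1 := hb (|B| / (-c) + |M - A| / (-c) + 1 + 1 / (-c)) (by
      have : 0 < -c := by linarith
      positivity)
    set t := |B| / (-c) + |M - A| / (-c) + 1 + 1 / (-c) with ht
    have hc : 0 < -c := by linarith
    have e : t * (-c) = |B| + |M - A| - c + 1 := by
      have := h.ne
      rw [ht]; field_simp; ring
    have t1 : 1 ≤ t := by
      have : 0 ≤ |B| / (-c) + |M - A| / (-c) + 1 / (-c) := by positivity
      linarith
    have e2 : t * B - t ^ 2 * c = t * (B + |B| + |M - A| - c + 1) := by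
      linear_combination t * e
    have : M - A + 1 ≤ t * (B + |B| + |M - A| - c + 1) := by
      have p1 : |M - A| + 1 ≤ B + |B| + |M - A| - c + 1 := by linarith [neg_abs_le B]
      nlinarith [le_abs_self (M - A), abs_nonneg (M - A)]
    linarith
  · have h1 := hb ((|M - A| + 1) / B) (by positivity)
    have e : (|M - A| + 1) / B * B = |M - A| + 1 := by field_simp
    have := mul_nonneg (sq_nonneg ((|M - A| + 1) / B)) (neg_nonneg.2 h)
    linarith [le_abs_self (M - A)]

/-- The sign of the form along `d` decides: unbounded if negative; affine if zero, so finite exactly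
where the slope is nonpositive; a concave parabola if positive, with the vertex on the ray or before
its origin. -/
theorem piecewiseSup_ray (q : QuadPoly) (p d : ℝ × ℝ) :
    q.PiecewiseSup q.IsCandidate (track p d (Ici 0)) := by
  have hp : p ∈ track p d (Ici 0) := ⟨0, by simp, by simp⟩
  rcases lt_trichotomy (q.form d) 0 with h | h | h
  · exact piecewiseSup_of_not_bddAbove fun s =>
      not_bddAbove_of_ray (fun t ht => ⟨t, ht, rfl⟩) (Or.inl h)
  · refine (q.piecewiseSup_singleton p).of_dominating (D₀ := {q.slopePoly p d}) (by simpa using hp)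
      (finite_singleton _) ?_ ?_ ?_
    · rintro r rfl; exact affine_isDegenerate _ _ _
    · rintro s hs r rfl
      by_contra! hc
      exact not_bddAbove_of_ray (S := track p d (Ici 0)) (fun t ht => ⟨t, ht, rfl⟩)
        (Or.inr ⟨h.le, hc⟩) hs
    · rintro s hs _ ⟨t, ht, rfl⟩
      refine ⟨p, rfl, ?_⟩
      simp only [payoff_add_smul, h]
      have := mul_nonpos_of_nonneg_of_nonpos ht (hs _ rfl)
      linarith
  · refine ⟨∅, {q.slopePoly p d}, {q.pointPoly p, q.linePoly p d}, by simp, by simp,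
      by simp, by simp, ?_, ?_, ?_, ?_⟩
    · rintro r rfl; exact affine_isDegenerate _ _ _
    · rintro r (rfl | rfl)
      exacts [Or.inl ⟨_, rfl⟩, Or.inr ⟨_, _, h, rfl⟩]
    · intro s
      simp only [mem_empty_iff_false, false_imp_iff, implies_true, iff_true]
      refine ⟨(q.linePoly p d).eval s, ?_⟩
      rintro _ ⟨_, ⟨t, -, rfl⟩, rfl⟩
      rw [linePoly_eval_eq_payoff h]
      exact payoff_add_smul_le_vertex h t
    · intro C hC _
      rcases hC _ rfl with hB | hB
      · refine ⟨q.pointPoly p, by simp, fun s hs => isLUB_payoff_of_mem hp (pointPoly_eval _ _ _) ?_⟩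
        rintro _ ⟨t, h0, rfl⟩
        simp only [payoff_add_smul]
        have := mul_nonpos_of_nonneg_of_nonpos h0 (hB s hs)
        have := mul_nonneg (sq_nonneg t) h.le
        linarith
      · refine ⟨q.linePoly p d, by simp, fun s hs => isLUB_payoff_of_mem
          (y := p + ((q.slopePoly p d).eval s / (2 * q.form d)) • d) ⟨_, ?_, rfl⟩
          (linePoly_eval_eq_payoff h) ?_⟩
        · exact div_nonneg (hB s hs) (by linarith)
        · rintro _ ⟨t, -, rfl⟩
          exact payoff_add_smul_le_vertex h t

end QuadPoly

/-! ### Convex subsets of a line -/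

namespace QuadPoly

/-- The admissible parameters form a closed interval starting at `0`, so the track is a segment
(possibly a point) or a ray. -/
theorem piecewiseSup_track_of_convex (q : QuadPoly) {K : Set (ℝ × ℝ)} (hc : IsClosed K)
    (hK : Convex ℝ K) {p : ℝ × ℝ} (hp : p ∈ K) (d : ℝ × ℝ) :
    q.PiecewiseSup q.IsCandidate (track p d {t | 0 ≤ t ∧ p + t • d ∈ K}) := by
  set I : Set ℝ := {t | 0 ≤ t ∧ p + t • d ∈ K} with hI
  have h0 : (0 : ℝ) ∈ I := ⟨le_rfl, by simpa using hp⟩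
  have hcl : IsClosed I := by
    have : Continuous fun t : ℝ => p + t • d := by fun_prop
    exact isClosed_Ici.inter (hc.preimage this)
  have hdown : ∀ t ∈ I, ∀ r, 0 ≤ r → r ≤ t → r ∈ I := by
    rintro t ⟨ht, htK⟩ r hr hrt
    refine ⟨hr, ?_⟩
    rcases hr.eq_or_lt with rfl | hr'
    · simpa using hp
    have ht' : 0 < t := hr'.trans_le hrt
    have := hK.add_smul_sub_mem hp htK (t := r / t) ⟨by positivity, (div_le_one ht').2 hrt⟩
    rw [add_sub_cancel_left, smul_smul, div_mul_cancel₀ _ ht'.ne'] at this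
    exact this
  by_cases hb : BddAbove I
  · have hβ : sSup I ∈ I := hcl.csSup_mem ⟨0, h0⟩ hb
    set β := sSup I
    have : track p d I = track p (β • d) (Icc 0 1) := by
      ext x
      constructor
      · rintro ⟨t, ht, rfl⟩
        have htβ : t ≤ β := le_csSup hb ht
        refine ⟨t / β, ⟨div_nonneg ht.1 hβ.1, div_le_one_of_le₀ htβ hβ.1⟩, ?_⟩
        simp only [smul_smul]
        rcases hβ.1.eq_or_lt with h | h
        · have : t = 0 := le_antisymm (htβ.trans h.ge) ht.1
          simp [this]
        · rw [div_mul_cancel₀ _ h.ne']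
      · rintro ⟨t, ⟨ht0, ht1⟩, rfl⟩
        refine ⟨t * β, hdown β hβ _ (mul_nonneg ht0 hβ.1) (mul_le_of_le_one_left hβ.1 ht1), ?_⟩
        simp only [smul_smul]
    rw [this]
    exact q.piecewiseSup_segment p _
  · have : I = Ici 0 := by
      refine Subset.antisymm (fun t ht => ht.1) fun r hr => ?_
      rw [not_bddAbove_iff] at hb
      obtain ⟨t, ht, hrt⟩ := hb r
      exact hdown t ht r hr hrt.le
    rw [this]
    exact q.piecewiseSup_ray p d

/-- Any point of `K` cuts it into two tracks with opposite directions. The empty set is a separate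
alternative because its image has no real least upper bound, so `PiecewiseSup` fails for it. -/
theorem piecewiseSup_of_subset_line (q : QuadPoly) {K : Set (ℝ × ℝ)} (hc : IsClosed K)
    (hK : Convex ℝ K) {u v w : ℝ} (huv : u ≠ 0 ∨ v ≠ 0)
    (hline : ∀ x ∈ K, u * x.1 + v * x.2 = w) :
    K = ∅ ∨ q.PiecewiseSup q.IsCandidate K := by
  rcases K.eq_empty_or_nonempty with h | ⟨p, hp⟩
  · exact Or.inl h
  right
  have key : K = track p (-v, u) {t | 0 ≤ t ∧ p + t • (-v, u) ∈ K} ∪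
      track p (v, -u) {t | 0 ≤ t ∧ p + t • (v, -u) ∈ K} := by
    ext x
    constructor
    · intro hx
      have hn : 0 < u ^ 2 + v ^ 2 := by
        rcases huv with h | h <;> positivity
      obtain ⟨t, ht⟩ : ∃ t : ℝ, p + t • (-v, u) = x := by
        have e : u * (x.1 - p.1) + v * (x.2 - p.2) = 0 := by
          linarith [hline x hx, hline p hp]
        refine ⟨(u * (x.2 - p.2) - v * (x.1 - p.1)) / (u ^ 2 + v ^ 2), ?_⟩
        ext <;> simp only [Prod.fst_add, Prod.snd_add, Prod.smul_fst, Prod.smul_snd,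
          smul_eq_mul] <;> field_simp
        · linear_combination -u * e
        · linear_combination -v * e
      rcases le_total 0 t with h | h
      · exact Or.inl ⟨t, ⟨h, by rwa [ht]⟩, ht⟩
      · have ht' : p + (-t) • (v, -u) = x := by rw [← ht]; simp
        exact Or.inr ⟨-t, ⟨by linarith, by rwa [ht']⟩, ht'⟩
    · rintro (⟨t, ht, rfl⟩ | ⟨t, ht, rfl⟩) <;> exact ht.2
  rw [key]
  exact (q.piecewiseSup_track_of_convex hc hK hp _).union
    (q.piecewiseSup_track_of_convex hc hK hp _)

end QuadPoly

/-! ### Polyhedral sets and their boundary -/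

/-- The polyhedral set given by a family of affine inequalities. -/
def polyhedron {ι : Type} (α β γ : ι → ℝ) : Set (ℝ × ℝ) :=
  {x | ∀ i, α i * x.1 + β i * x.2 ≤ γ i}

/-- The points of the polyhedral set at which some inequality is an equality. -/
def activeSet {ι : Type} (α β γ : ι → ℝ) : Set (ℝ × ℝ) :=
  {x | x ∈ polyhedron α β γ ∧ ∃ i, α i * x.1 + β i * x.2 = γ i}

section Polyhedron

variable {ι : Type} {α β γ : ι → ℝ}

theorem isClosed_polyhedron : IsClosed (polyhedron α β γ) := by
  simp only [polyhedron, ofPred_forall]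
  exact isClosed_iInter fun i => isClosed_le (by fun_prop) (by fun_prop)

theorem convex_polyhedron : Convex ℝ (polyhedron α β γ) := by
  intro x hx y hy r t hr ht hrt i
  have h1 := mul_le_mul_of_nonneg_left (hx i) hr
  have h2 := mul_le_mul_of_nonneg_left (hy i) ht
  have h3 : γ i = r * γ i + t * γ i := by rw [← add_mul, hrt, one_mul]
  simp only [Prod.fst_add, Prod.snd_add, Prod.smul_fst, Prod.smul_snd, smul_eq_mul]
  linarith

theorem QuadPoly.piecewiseSup_slice (q : QuadPoly) {u v : ℝ} (huv : u ≠ 0 ∨ v ≠ 0) (w : ℝ) :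
    {x | x ∈ polyhedron α β γ ∧ u * x.1 + v * x.2 = w} = ∅ ∨
      q.PiecewiseSup q.IsCandidate {x | x ∈ polyhedron α β γ ∧ u * x.1 + v * x.2 = w} := by
  refine q.piecewiseSup_of_subset_line ?_ ?_ huv fun x hx => hx.2
  · exact isClosed_polyhedron.inter (isClosed_eq (by fun_prop) (by fun_prop))
  · refine convex_polyhedron.inter fun x hx y hy r t hr ht hrt => ?_
    change u * x.1 + v * x.2 = w at hx
    change u * y.1 + v * y.2 = w at hy
    change u * (r * x.1 + t * y.1) + v * (r * x.2 + t * y.2) = w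
    linear_combination r * hx + t * hy + w * hrt

/-- The boundary is the finite union of the slices on which one given inequality is tight, and each
slice lies on a line. -/
theorem QuadPoly.piecewiseSup_activeSet [Finite ι] (q : QuadPoly)
    (hne : ∀ i, α i ≠ 0 ∨ β i ≠ 0) :
    activeSet α β γ = ∅ ∨ q.PiecewiseSup q.IsCandidate (activeSet α β γ) := by
  have : ∀ t : Set ι, t.Finite →
      (⋃ i ∈ t, {x | x ∈ polyhedron α β γ ∧ α i * x.1 + β i * x.2 = γ i}) = ∅ ∨
      q.PiecewiseSup q.IsCandidate
        (⋃ i ∈ t, {x | x ∈ polyhedron α β γ ∧ α i * x.1 + β i * x.2 = γ i}) := by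
    intro t ht
    induction t, ht using Set.Finite.induction_on with
    | empty => left; simp
    | @insert i t _ _ ih =>
      rw [biUnion_insert]
      rcases q.piecewiseSup_slice (α := α) (β := β) (γ := γ) (hne i) (γ i) with h | h <;>
        rcases ih with h' | h'
      · left; rw [h, h', union_empty]
      · right; rwa [h, empty_union]
      · right; rwa [h', union_empty]
      · right; exact h.union h'
  have e : activeSet α β γ =
      ⋃ i ∈ (univ : Set ι), {x | x ∈ polyhedron α β γ ∧ α i * x.1 + β i * x.2 = γ i} := by
    ext x
    simp [activeSet]
  rw [e]
  exact this _ finite_univ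

/-- A segment that starts in the polyhedral set and does not end in its interior meets the
boundary. -/
theorem exists_mem_activeSet [Finite ι] {x e : ℝ × ℝ} (hx : x ∈ polyhedron α β γ) {i : ι}
    (hi : γ i ≤ α i * (x + e).1 + β i * (x + e).2) :
    ∃ t : ℝ, 0 ≤ t ∧ t ≤ 1 ∧ x + t • e ∈ activeSet α β γ := by
  have := Fintype.ofFinite ι
  have hu : (Finset.univ : Finset ι).Nonempty := ⟨i, Finset.mem_univ i⟩
  let F : ι → ℝ → ℝ := fun j t => γ j - (α j * (x + t • e).1 + β j * (x + t • e).2)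
  -- The smallest slack along the segment is continuous and passes from nonnegative to nonpositive;
  -- at a zero all constraints hold and one is tight.
  let m : ℝ → ℝ := fun t => Finset.univ.inf' hu fun j => F j t
  have hm : Continuous m := by
    refine Continuous.finset_inf'_apply hu fun j _ => ?_
    simp only [F]
    fun_prop
  have h0 : 0 ≤ m 0 := by
    refine Finset.le_inf' _ _ fun j _ => ?_
    have := hx j
    simp only [F, zero_smul, add_zero]
    linarith
  have h1 : m 1 ≤ 0 := by
    refine (Finset.inf'_le (fun j => F j 1) (Finset.mem_univ i)).trans ?_
    simp only [F, one_smul]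
    linarith
  obtain ⟨t, ⟨ht0, ht1⟩, ht⟩ := intermediate_value_Icc' zero_le_one hm.continuousOn ⟨h1, h0⟩
  refine ⟨t, ht0, ht1, fun j => ?_, ?_⟩
  · have : m t ≤ F j t := Finset.inf'_le (fun j => F j t) (Finset.mem_univ j)
    simp only [F] at this
    linarith
  · obtain ⟨j, -, hj⟩ := Finset.exists_mem_eq_inf' hu fun j => F j t
    refine ⟨j, ?_⟩
    have : F j t = 0 := by rw [← hj]; exact ht
    simp only [F] at this
    linarith

theorem exists_mem_activeSet_of_direction [Finite ι] {x d : ℝ × ℝ} (hx : x ∈ polyhedron α β γ)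
    {i : ι} (hi : 0 < α i * d.1 + β i * d.2) :
    ∃ t : ℝ, 0 ≤ t ∧ x + t • d ∈ activeSet α β γ := by
  set r := (γ i - (α i * x.1 + β i * x.2)) / (α i * d.1 + β i * d.2) with hr
  have hr0 : 0 ≤ r := div_nonneg (sub_nonneg.2 (hx i)) hi.le
  have e : r * (α i * d.1 + β i * d.2) = γ i - (α i * x.1 + β i * x.2) := by
    rw [hr, div_mul_cancel₀ _ hi.ne']
  obtain ⟨t, h0, -, h⟩ := exists_mem_activeSet (e := r • d) hx (i := i) (by
    simp only [Prod.fst_add, Prod.snd_add, Prod.smul_fst, Prod.smul_snd, smul_eq_mul]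
    linarith)
  exact ⟨t * r, mul_nonneg h0 hr0, by rwa [mul_smul]⟩

end Polyhedron

/-! ### Polyhedral sets with a direction of concavity of `q` -/

namespace QuadPoly

/-- When the form vanishes at `d`, boundedness forces `d · s ≤ q.slope x d` for every `x ∈ S`.
Taking the infimum over `x` condenses these conditions into one affine inequality, or shows that no
`s` satisfies them. -/
theorem recession_dichotomy {q : QuadPoly} {S : Set (ℝ × ℝ)} (hne : S.Nonempty) {d : ℝ × ℝ}
    (hS : ∀ x ∈ S, ∀ t : ℝ, 0 ≤ t → x + t • d ∈ S) (hd : q.form d ≤ 0) :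
    (∀ s, ¬ BddAbove (q.payoff s '' S)) ∨
      q.form d = 0 ∧ ∃ r : QuadPoly, r.IsDegenerate ∧
        (∀ s, BddAbove (q.payoff s '' S) → r.eval s ≤ 0) ∧
        ∀ s, r.eval s ≤ 0 → ∀ x ∈ S, (q.slopePoly x d).eval s ≤ 0 := by
  rcases hd.lt_or_eq with h | h
  · obtain ⟨p, hp⟩ := hne
    exact Or.inl fun s => not_bddAbove_of_ray (hS p hp) (Or.inl h)
  have hle : ∀ s, BddAbove (q.payoff s '' S) → ∀ x ∈ S, d.1 * s.1 + d.2 * s.2 ≤ q.slope x d := by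
    intro s hs x hx
    by_contra! hlt
    refine not_bddAbove_of_ray (hS x hx) (Or.inr ⟨hd, ?_⟩) hs
    rw [slopePoly, affine_eval]
    linarith
  by_cases hb : BddBelow ((fun x => q.slope x d) '' S)
  · refine Or.inr ⟨h, affine d.1 d.2 (-sInf ((fun x => q.slope x d) '' S)),
      affine_isDegenerate _ _ _, fun s hs => ?_, fun s hs x hx => ?_⟩
    · have : d.1 * s.1 + d.2 * s.2 ≤ sInf ((fun x => q.slope x d) '' S) :=
        le_csInf (hne.image _) (by rintro _ ⟨x, hx, rfl⟩; exact hle s hs x hx)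
      rw [affine_eval]
      linarith
    · have := csInf_le hb ⟨x, hx, rfl⟩
      rw [affine_eval] at hs
      rw [slopePoly, affine_eval]
      linarith
  · refine Or.inl fun s hs => hb ⟨d.1 * s.1 + d.2 * s.2, ?_⟩
    rintro _ ⟨x, hx, rfl⟩
    exact hle s hs x hx

theorem slopePoly_neg (q : QuadPoly) (x d s : ℝ × ℝ) :
    (q.slopePoly x (-d)).eval s = -(q.slopePoly x d).eval s := by
  simp only [slopePoly, affine_eval, slope, Prod.fst_neg, Prod.snd_neg]
  ring

theorem form_neg (q : QuadPoly) (d : ℝ × ℝ) : q.form (-d) = q.form d := by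
  simp only [form, Prod.fst_neg, Prod.snd_neg]
  ring

section Polyhedron

variable {ι : Type} [Finite ι] {α β γ : ι → ℝ}

theorem mem_polyhedron_add_smul {ι : Type} {α β γ : ι → ℝ} {d : ℝ × ℝ}
    (hd : ∀ i, α i * d.1 + β i * d.2 ≤ 0) :
    ∀ x ∈ polyhedron α β γ, ∀ t : ℝ, 0 ≤ t → x + t • d ∈ polyhedron α β γ := by
  intro x hx t ht i
  have := mul_nonpos_of_nonneg_of_nonpos ht (hd i)
  have := hx i
  simp only [Prod.fst_add, Prod.snd_add, Prod.smul_fst, Prod.smul_snd, smul_eq_mul]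
  linarith

/-- Where the supremum is finite, the payoff is affine and nonincreasing along `d`, so walking
backwards to the boundary loses nothing. -/
theorem piecewiseSup_of_recession {q : QuadPoly} (hne : ∀ i, α i ≠ 0 ∨ β i ≠ 0)
    (hP : (polyhedron α β γ).Nonempty) {d : ℝ × ℝ} (hd : q.form d ≤ 0)
    (hrec : ∀ i, α i * d.1 + β i * d.2 ≤ 0) {i : ι} (hi : α i * d.1 + β i * d.2 < 0) :
    q.PiecewiseSup q.IsCandidate (polyhedron α β γ) := by
  rcases recession_dichotomy hP (mem_polyhedron_add_smul hrec) hd with h | ⟨hf, r, hr, hb, hr'⟩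
  · exact piecewiseSup_of_not_bddAbove h
  have hex : ∀ x ∈ polyhedron α β γ, ∃ t : ℝ, 0 ≤ t ∧ x + t • (-d) ∈ activeSet α β γ :=
    fun x hx => exists_mem_activeSet_of_direction hx (i := i) (by
      simp only [Prod.fst_neg, Prod.snd_neg]; linarith)
  rcases q.piecewiseSup_activeSet (γ := γ) hne with h0 | hE
  · obtain ⟨x, hx⟩ := hP
    obtain ⟨t, -, ht⟩ := hex x hx
    rw [h0] at ht
    exact ht.elim
  refine hE.of_dominating (D₀ := {r}) (fun x hx => hx.1) (finite_singleton _)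
    (by simpa using hr) (by simpa using hb) fun s hs x hx => ?_
  obtain ⟨t, ht, hy⟩ := hex x hx
  refine ⟨_, hy, ?_⟩
  rw [payoff_add_smul, form_neg, hf, slopePoly_neg]
  have := mul_nonpos_of_nonneg_of_nonpos ht (hr' s (hs r rfl) x hx)
  linarith

/-- The case of a direction along which the polynomial is concave. -/
theorem piecewiseSup_of_form_nonpos {q : QuadPoly} (hne : ∀ i, α i ≠ 0 ∨ β i ≠ 0)
    (hP : (polyhedron α β γ).Nonempty) {d : ℝ × ℝ} (hd0 : d ≠ 0) (hd : q.form d ≤ 0) :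
    q.PiecewiseSup q.IsCandidate (polyhedron α β γ) := by
  by_cases h1 : ∃ i, 0 < α i * d.1 + β i * d.2 <;> by_cases h2 : ∃ i, α i * d.1 + β i * d.2 < 0
  -- Every line along `d` leaves the set at both ends; by convexity of the payoff along it, walking
  -- in the uphill direction reaches a boundary point that is at least as good.
  · obtain ⟨i, hi⟩ := h1
    obtain ⟨j, hj⟩ := h2
    have hex : ∀ x ∈ polyhedron α β γ, ∃ t : ℝ, 0 ≤ t ∧ x + t • d ∈ activeSet α β γ :=
      fun x hx => exists_mem_activeSet_of_direction hx hi
    have hex' : ∀ x ∈ polyhedron α β γ, ∃ t : ℝ, 0 ≤ t ∧ x + t • (-d) ∈ activeSet α β γ :=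
      fun x hx => exists_mem_activeSet_of_direction hx (i := j) (by
        simp only [Prod.fst_neg, Prod.snd_neg]; linarith)
    rcases q.piecewiseSup_activeSet (γ := γ) hne with h0 | hE
    · obtain ⟨x, hx⟩ := hP
      obtain ⟨t, -, ht⟩ := hex x hx
      rw [h0] at ht
      exact ht.elim
    refine hE.of_dominating (D₀ := ∅) (fun x hx => hx.1) finite_empty (by simp) (by simp)
      fun s _ x hx => ?_
    rcases le_total 0 ((q.slopePoly x d).eval s) with hB | hB
    · obtain ⟨t, ht, hy⟩ := hex x hx
      refine ⟨_, hy, ?_⟩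
      rw [payoff_add_smul]
      have := mul_nonneg ht hB
      have := mul_nonneg (sq_nonneg t) (neg_nonneg.2 hd)
      linarith
    · obtain ⟨t, ht, hy⟩ := hex' x hx
      refine ⟨_, hy, ?_⟩
      rw [payoff_add_smul, form_neg, slopePoly_neg]
      have := mul_nonpos_of_nonneg_of_nonpos ht hB
      have := mul_nonneg (sq_nonneg t) (neg_nonneg.2 hd)
      linarith
  · obtain ⟨i, hi⟩ := h1
    push Not at h2
    exact piecewiseSup_of_recession hne hP (d := -d) (i := i) (by rwa [form_neg])
      (fun j => by have := h2 j; simp only [Prod.fst_neg, Prod.snd_neg]; linarith)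
      (by simp only [Prod.fst_neg, Prod.snd_neg]; linarith)
  · obtain ⟨i, hi⟩ := h2
    push Not at h1
    exact piecewiseSup_of_recession hne hP hd h1 hi
  -- The set is invariant along `d` and may have no boundary. Finiteness forces the slope along `d`
  -- to vanish, so each point may be projected onto the slice orthogonal to `d`.
  · push Not at h1 h2
    have hS := mem_polyhedron_add_smul (γ := γ) h1
    have hS' := mem_polyhedron_add_smul (γ := γ) (d := -d) (α := α) (β := β)
      fun j => by have := h2 j; simp only [Prod.fst_neg, Prod.snd_neg]; linarith
    rcases recession_dichotomy hP hS hd with h | ⟨hf, r, hr, hb, hrs⟩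
    · exact piecewiseSup_of_not_bddAbove h
    rcases recession_dichotomy hP hS' (by rwa [form_neg]) with h | ⟨-, r', hr', hb', hrs'⟩
    · exact piecewiseSup_of_not_bddAbove h
    have hdd : d.1 ≠ 0 ∨ d.2 ≠ 0 := by
      by_contra! h
      exact hd0 (Prod.ext h.1 h.2)
    have hn : 0 < d.1 ^ 2 + d.2 ^ 2 := by rcases hdd with h | h <;> positivity
    have hex : ∀ x ∈ polyhedron α β γ, ∃ t : ℝ,
        x + t • d ∈ {x | x ∈ polyhedron α β γ ∧ d.1 * x.1 + d.2 * x.2 = 0} := by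
      intro x hx
      refine ⟨-(d.1 * x.1 + d.2 * x.2) / (d.1 ^ 2 + d.2 ^ 2), ?_, ?_⟩
      · rcases le_total 0 (-(d.1 * x.1 + d.2 * x.2) / (d.1 ^ 2 + d.2 ^ 2)) with h | h
        · exact hS x hx _ h
        · have := hS' x hx _ (neg_nonneg.2 h)
          rwa [neg_smul_neg] at this
      · simp only [Prod.fst_add, Prod.snd_add, Prod.smul_fst, Prod.smul_snd, smul_eq_mul]
        field_simp
        ring
    rcases q.piecewiseSup_slice (α := α) (β := β) (γ := γ) hdd 0 with h0 | hE
    · obtain ⟨x, hx⟩ := hP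
      obtain ⟨t, ht⟩ := hex x hx
      rw [h0] at ht
      exact ht.elim
    refine hE.of_dominating (D₀ := {r, r'}) (fun x hx => hx.1) (by simp) ?_ ?_ fun s hs x hx => ?_
    · rintro _ (rfl | rfl) <;> assumption
    · rintro s hs _ (rfl | rfl)
      exacts [hb s hs, hb' s hs]
    · obtain ⟨t, hy⟩ := hex x hx
      refine ⟨_, hy, ?_⟩
      have e1 := hrs s (hs r (by simp)) x hx
      have e2 := hrs' s (hs r' (by simp)) x hx
      rw [slopePoly_neg] at e2
      have e : (q.slopePoly x d).eval s = 0 := by linarith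
      rw [payoff_add_smul, hf, e]
      simp

/-! ### The positive definite case -/

/-- The unconstrained maximizer of the payoff. -/
noncomputable def maximizer (q : QuadPoly) (s : ℝ × ℝ) : ℝ × ℝ :=
  ((2 * q.c * (s.1 - q.d) - q.b * (s.2 - q.e)) / (4 * q.a * q.c - q.b ^ 2),
    (2 * q.a * (s.2 - q.e) - q.b * (s.1 - q.d)) / (4 * q.a * q.c - q.b ^ 2))

/-- The unconstrained maximum of the payoff, as a polynomial in `s`. -/
noncomputable def maxPoly (q : QuadPoly) : QuadPoly :=
  ⟨q.c / (4 * q.a * q.c - q.b ^ 2), -q.b / (4 * q.a * q.c - q.b ^ 2),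
    q.a / (4 * q.a * q.c - q.b ^ 2),
    (-2 * q.c * q.d + q.b * q.e) / (4 * q.a * q.c - q.b ^ 2),
    (q.b * q.d - 2 * q.a * q.e) / (4 * q.a * q.c - q.b ^ 2),
    (q.c * q.d ^ 2 - q.b * q.d * q.e + q.a * q.e ^ 2) / (4 * q.a * q.c - q.b ^ 2) - q.f⟩

theorem discr_pos_of_form_pos {q : QuadPoly} (h : ∀ d, d ≠ 0 → 0 < q.form d) :
    0 < 4 * q.a * q.c - q.b ^ 2 := by
  have ha : 0 < q.a := by
    have := h (1, 0) (by simp)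
    simpa [form] using this
  have := h (-q.b, 2 * q.a) (by simp [ha.ne'])
  have e : q.form (-q.b, 2 * q.a) = q.a * (4 * q.a * q.c - q.b ^ 2) := by
    simp only [form]; ring
  rw [e] at this
  exact pos_of_mul_pos_right this ha.le

theorem payoff_maximizer {q : QuadPoly} (h : 4 * q.a * q.c - q.b ^ 2 ≠ 0) (s : ℝ × ℝ) :
    q.payoff s (q.maximizer s) = q.maxPoly.eval s := by
  obtain ⟨D, hD⟩ : ∃ D, D = 4 * q.a * q.c - q.b ^ 2 := ⟨_, rfl⟩
  simp only [maximizer, maxPoly, payoff, eval, ← hD] at h ⊢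
  field_simp
  rw [hD]
  ring

theorem slope_maximizer {q : QuadPoly} (h : 4 * q.a * q.c - q.b ^ 2 ≠ 0) (s d : ℝ × ℝ) :
    (q.slopePoly (q.maximizer s) d).eval s = 0 := by
  obtain ⟨D, hD⟩ : ∃ D, D = 4 * q.a * q.c - q.b ^ 2 := ⟨_, rfl⟩
  simp only [slopePoly, affine_eval, slope, maximizer, ← hD] at h ⊢
  field_simp
  rw [hD]
  ring

/-- The maximizer is affine in `s`, so affine sign conditions tell whether it satisfies each
constraint. If it does not lie in the interior, the segment from any feasible point to it meets the
boundary at a point with at least as large a payoff. These signs choose between `maxPoly` and the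
boundary, so `maxPoly` is never compared with a candidate and need not be one. -/
theorem piecewiseSup_of_form_pos {q : QuadPoly} (hne : ∀ i, α i ≠ 0 ∨ β i ≠ 0)
    (hP : (polyhedron α β γ).Nonempty) (hq : ∀ d, d ≠ 0 → 0 < q.form d) :
    q.PiecewiseSup (fun _ => True) (polyhedron α β γ) := by
  have hΔ := (discr_pos_of_form_pos hq).ne'
  have hform : ∀ d, 0 ≤ q.form d := fun d => by
    rcases eq_or_ne d 0 with rfl | h
    · simp [form]
    · exact (hq d h).le
  have hline : ∀ s (d : ℝ × ℝ) (t : ℝ),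
      q.payoff s (q.maximizer s + t • d) = q.maxPoly.eval s - t ^ 2 * q.form d := by
    intro s d t
    rw [payoff_add_smul, slope_maximizer hΔ, payoff_maximizer hΔ]
    ring
  have hmax : ∀ s x, q.payoff s x ≤ q.maxPoly.eval s := by
    intro s x
    have := hline s (x - q.maximizer s) 1
    rw [one_smul, add_sub_cancel] at this
    rw [this]
    linarith [hform (x - q.maximizer s)]
  have hbdd : ∀ s (S : Set (ℝ × ℝ)), BddAbove (q.payoff s '' S) := fun s S =>
    ⟨q.maxPoly.eval s, by rintro _ ⟨x, -, rfl⟩; exact hmax s x⟩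
  let B : ι → QuadPoly := fun i => affine
    ((2 * q.c * α i - q.b * β i) / (4 * q.a * q.c - q.b ^ 2))
    ((2 * q.a * β i - q.b * α i) / (4 * q.a * q.c - q.b ^ 2))
    ((α i * (-2 * q.c * q.d + q.b * q.e) + β i * (-2 * q.a * q.e + q.b * q.d)) /
      (4 * q.a * q.c - q.b ^ 2) - γ i)
  have hB : ∀ i s, (B i).eval s =
      α i * (q.maximizer s).1 + β i * (q.maximizer s).2 - γ i := by
    intro i s
    simp only [B, affine_eval, maximizer]
    ring
  have hexit : ∀ i s, 0 ≤ (B i).eval s → ∀ x ∈ polyhedron α β γ,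
      ∃ y ∈ activeSet α β γ, q.payoff s x ≤ q.payoff s y := by
    intro i s hs x hx
    obtain ⟨t, h0, h1, ht⟩ := exists_mem_activeSet (e := q.maximizer s - x) hx (i := i) (by
      rw [add_sub_cancel]; linarith [hB i s])
    refine ⟨_, ht, ?_⟩
    have e : x + t • (q.maximizer s - x) = q.maximizer s + (1 - t) • (x - q.maximizer s) := by
      module
    have e' := hline s (x - q.maximizer s) 1
    rw [one_smul, add_sub_cancel] at e'
    rw [e, hline, e']
    have := hform (x - q.maximizer s)
    -- The gain is `1 - (1 - t)² = t (2 - t)` times the form.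
    nlinarith [mul_nonneg (mul_nonneg h0 (by linarith : 0 ≤ 2 - t)) this]
  have hBdeg : ∀ i, (B i).IsDegenerate := fun i => affine_isDegenerate _ _ _
  have interior : ∀ C : Set (ℝ × ℝ), (∀ i, ∀ s ∈ C, (B i).eval s ≤ 0) → ∀ s ∈ C,
      IsLUB (q.payoff s '' polyhedron α β γ) (q.maxPoly.eval s) := by
    intro C hC s hs
    refine isLUB_payoff_of_mem (y := q.maximizer s) (fun i => ?_) (payoff_maximizer hΔ s).symm
      fun x _ => ?_
    · linarith [hC i s hs, hB i s]
    · rw [payoff_maximizer hΔ]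
      exact hmax s x
  rcases q.piecewiseSup_activeSet (γ := γ) hne with h0 | ⟨D, L, T, -, hL, hT, -, hLd, -, -, hsup⟩
  · refine ⟨∅, range B, {q.maxPoly}, by simp, finite_range _, by simp, by simp, ?_, by simp,
      fun s => by simp [hbdd], fun C hC _ => ⟨_, rfl, ?_⟩⟩
    · rintro _ ⟨i, rfl⟩; exact hBdeg i
    · by_cases hcase : ∀ i, ∀ s ∈ C, (B i).eval s ≤ 0
      · exact interior C hcase
      · push Not at hcase
        obtain ⟨i, s₀, hs₀, hpos⟩ := hcase
        obtain ⟨x, hx⟩ := hP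
        obtain ⟨y, hy, -⟩ := hexit i s₀ hpos.le x hx
        rw [h0] at hy
        exact hy.elim
  · refine ⟨∅, L ∪ range B, insert q.maxPoly T, by simp, hL.union (finite_range _), hT.insert _,
      by simp, ?_, by simp, fun s => by simp [hbdd], fun C hC _ => ?_⟩
    · rintro _ (h | ⟨i, rfl⟩)
      exacts [hLd _ h, hBdeg i]
    · by_cases hcase : ∀ i, ∀ s ∈ C, (B i).eval s ≤ 0
      · exact ⟨_, mem_insert _ _, interior C hcase⟩
      · push Not at hcase
        obtain ⟨i, s₀, hs₀, hpos⟩ := hcase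
        have hBi : ∀ s ∈ C, 0 ≤ (B i).eval s :=
          (hC (B i) (Or.inr ⟨i, rfl⟩)).resolve_left fun h => (h s₀ hs₀).not_gt hpos
        obtain ⟨g, hg, hgs⟩ := hsup C (hC.mono subset_union_left) fun s _ => hbdd s _
        refine ⟨g, Or.inr hg, fun s hs => ?_⟩
        rw [IsLUB, upperBounds_payoff_eq (fun x hx => hx.1) (hexit i s (hBi s hs))]
        exact hgs s hs

end Polyhedron

end QuadPoly

/-! ### General polyhedral sets and the domain of the conjugate -/

namespace QuadPoly

theorem exists_piecewiseSup {q : QuadPoly} {P : Set (ℝ × ℝ)} (hP : IsPolyhedralSet P)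
    (hne : P.Nonempty) : q.PiecewiseSup (fun _ => True) P := by
  obtain ⟨m, α, β, γ, rfl⟩ := hP
  -- Constraints with zero normal vector hold everywhere, since they hold at one point; dropping
  -- them makes every remaining equality define a line.
  let ι := {i : Fin m // α i ≠ 0 ∨ β i ≠ 0}
  have e : {x : ℝ × ℝ | ∀ i, α i * x.1 + β i * x.2 ≤ γ i} =
      polyhedron (fun i : ι => α i) (fun i : ι => β i) (fun i : ι => γ i) := by
    obtain ⟨y, hy⟩ := hne
    refine Subset.antisymm (fun x hx i => hx i) fun x hx i => ?_
    by_cases h : α i ≠ 0 ∨ β i ≠ 0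
    · exact hx ⟨i, h⟩
    · push Not at h
      have := hy i
      simpa [h.1, h.2] using this
  rw [e] at hne ⊢
  by_cases hq : ∃ d, d ≠ 0 ∧ q.form d ≤ 0
  · obtain ⟨d, hd0, hd⟩ := hq
    obtain ⟨D, L, T, h1, h2, h3, h4, h5, -, h⟩ :=
      piecewiseSup_of_form_nonpos (fun i : ι => i.2) hne hd0 hd
    exact ⟨D, L, T, h1, h2, h3, h4, h5, fun _ _ => trivial, h⟩
  · push Not at hq
    exact piecewiseSup_of_form_pos (fun i : ι => i.2) hne hq

theorem convex_bddAbove_payoff (q : QuadPoly) (S : Set (ℝ × ℝ)) :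
    Convex ℝ {s | BddAbove (q.payoff s '' S)} := by
  rintro s ⟨M, hM⟩ s' ⟨M', hM'⟩ r t hr ht hrt
  refine ⟨r * M + t * M', ?_⟩
  rintro _ ⟨x, hx, rfl⟩
  have h1 := mul_le_mul_of_nonneg_left (hM ⟨x, hx, rfl⟩) hr
  have h2 := mul_le_mul_of_nonneg_left (hM' ⟨x, hx, rfl⟩) ht
  have : q.payoff (r • s + t • s') x = r * q.payoff s x + t * q.payoff s' x := by
    simp only [payoff, Prod.fst_add, Prod.snd_add, Prod.smul_fst, Prod.smul_snd, smul_eq_mul]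
    linear_combination q.eval x * hrt
  rw [this]
  exact add_le_add h1 h2

end QuadPoly

/-! ### Conjugates, envelopes and minima of pieces -/

theorem conjugate_restrictTo (q : QuadPoly) (P : Set (ℝ × ℝ)) (s : ℝ × ℝ) :
    conjugate (restrictTo q.eval P) s = ⨆ x ∈ P, ((q.payoff s x : ℝ) : EReal) := by
  refine iSup_congr fun x => ?_
  by_cases hx : x ∈ P
  · simp [restrictTo, indicatorFn, hx, QuadPoly.payoff]
  · simp [restrictTo, indicatorFn, hx]

theorem conjugate_restrictTo_of_isLUB {q : QuadPoly} {P : Set (ℝ × ℝ)} {s : ℝ × ℝ} {r : ℝ}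
    (h : IsLUB (q.payoff s '' P) r) :
    conjugate (restrictTo q.eval P) s = (r : EReal) := by
  rw [conjugate_restrictTo]
  apply le_antisymm
  · exact iSup₂_le fun x hx => EReal.coe_le_coe_iff.2 (h.1 ⟨x, hx, rfl⟩)
  · by_contra! hlt
    obtain ⟨z, hz1, hz2⟩ := EReal.lt_iff_exists_real_btwn.1 hlt
    refine (EReal.coe_lt_coe_iff.1 hz2).not_ge (h.2 ?_)
    rintro _ ⟨x, hx, rfl⟩
    exact EReal.coe_le_coe_iff.1
      ((le_iSup₂ (f := fun x (_ : x ∈ P) => ((q.payoff s x : ℝ) : EReal)) x hx).trans hz1.le)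

theorem conjugate_restrictTo_lt_top_iff {q : QuadPoly} {P : Set (ℝ × ℝ)} {s : ℝ × ℝ}
    (hne : P.Nonempty) :
    conjugate (restrictTo q.eval P) s < ⊤ ↔ BddAbove (q.payoff s '' P) := by
  constructor
  · intro h
    obtain ⟨z, hz1, -⟩ := EReal.lt_iff_exists_real_btwn.1 h
    rw [conjugate_restrictTo] at hz1
    refine ⟨z, ?_⟩
    rintro _ ⟨x, hx, rfl⟩
    exact EReal.coe_le_coe_iff.1
      ((le_iSup₂ (f := fun x (_ : x ∈ P) => ((q.payoff s x : ℝ) : EReal)) x hx).trans hz1.le)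
  · intro h
    rw [conjugate_restrictTo_of_isLUB (isLUB_csSup (hne.image _) h)]
    exact EReal.coe_lt_top _

/-- The conjugate does not see the passage to the closed convex envelope. -/
theorem conjugate_convEnvelope {f : ℝ × ℝ → EReal} {x₀ : ℝ × ℝ} (hx₀ : f x₀ ≠ ⊤) :
    conjugate (convEnvelope f) = conjugate f := by
  funext s
  apply le_antisymm
  · induction h : conjugate f s with
    | bot =>
      have h1 : ((x₀.1 * s.1 + x₀.2 * s.2 : ℝ) : EReal) - f x₀ ≤ ⊥ := by
        rw [← h]
        exact le_iSup (fun x : ℝ × ℝ => ((x.1 * s.1 + x.2 * s.2 : ℝ) : EReal) - f x) x₀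
      rw [le_bot_iff, sub_eq_add_neg, EReal.add_eq_bot_iff] at h1
      exact (h1.elim (EReal.coe_ne_bot _) fun h2 => hx₀ (EReal.neg_eq_bot_iff.1 h2)).elim
    | top => exact le_top
    | coe c =>
      -- By the definition of the conjugate value `c`, this affine function lies below `f`, so it
      -- competes in the envelope.
      let g : ℝ × ℝ → EReal := fun x => ((x.1 * s.1 + x.2 * s.2 - c : ℝ) : EReal)
      have hg : LowerSemicontinuous g ∧ IsConvexFn g ∧ ∀ y, g y ≤ f y := by
        refine ⟨?_, ?_, fun y => ?_⟩
        · have : Continuous g := continuous_coe_real_ereal.comp (by fun_prop)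
          exact this.lowerSemicontinuous
        · rintro ⟨x, a⟩ hx ⟨y, b⟩ hy r t hr ht hrt
          simp only [g, mem_ofPred_eq, EReal.coe_le_coe_iff, Prod.fst_add, Prod.snd_add,
            Prod.smul_fst, Prod.smul_snd, smul_eq_mul] at hx hy ⊢
          have h1 := mul_le_mul_of_nonneg_left hx hr
          have h2 := mul_le_mul_of_nonneg_left hy ht
          have h3 : c = r * c + t * c := by rw [← add_mul, hrt, one_mul]
          linarith
        · have hy : ((y.1 * s.1 + y.2 * s.2 : ℝ) : EReal) - f y ≤ (c : EReal) := by
            rw [← h]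
            exact le_iSup (fun x : ℝ × ℝ => ((x.1 * s.1 + x.2 * s.2 : ℝ) : EReal) - f x) y
          induction hfy : f y with
          | bot => rw [hfy, EReal.coe_sub_bot] at hy; exact absurd hy (by simp)
          | top => exact le_top
          | coe w =>
            rw [hfy, ← EReal.coe_sub, EReal.coe_le_coe_iff] at hy
            exact EReal.coe_le_coe_iff.2 (by linarith)
      refine iSup_le fun x => ?_
      have hx : g x ≤ convEnvelope f x :=
        le_iSup₂ (f := fun (g : ℝ × ℝ → EReal)
          (_ : LowerSemicontinuous g ∧ IsConvexFn g ∧ ∀ y, g y ≤ f y) => g x) g hg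
      refine (EReal.sub_le_sub le_rfl hx).trans ?_
      simp only [g]
      rw [← EReal.coe_sub, EReal.coe_le_coe_iff]
      linarith
  · exact iSup_mono fun x => EReal.sub_le_sub le_rfl (iSup₂_le fun g hg => hg.2.2 x)

theorem conjugate_eq_iSup_of_isMinOfPieces {F : ℝ × ℝ → EReal} {n : ℕ} {r : Fin n → ℝ × ℝ → ℝ}
    {R : Fin n → Set (ℝ × ℝ)} (h : IsMinOfPieces F r R) :
    (fun s => ⨆ j, conjugate (restrictTo (r j) (R j)) s) = conjugate F := by
  funext s
  simp only [conjugate]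
  rw [iSup_comm]
  refine iSup_congr fun x => ?_
  rw [h x]
  apply le_antisymm
  · exact iSup_le fun j => EReal.sub_le_sub le_rfl (iInf_le _ j)
  · rcases isEmpty_or_nonempty (Fin n) with he | he
    -- With no pieces the minimum is `⊤`, which contributes `⊥` to the conjugate.
    · rw [iInf_of_empty, EReal.sub_top]
      exact bot_le
    · obtain ⟨j, hj⟩ := exists_eq_ciInf_of_finite (f := fun j => restrictTo (r j) (R j) x)
      rw [← hj]
      exact le_iSup (fun j => ((x.1 * s.1 + x.2 * s.2 : ℝ) : EReal) - restrictTo (r j) (R j) x) j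

/-! ### Parabolic cells from sign patterns -/

theorem isParabolicRegion_of_finite {F : Set QuadPoly} (hF : F.Finite)
    (hp : ∀ p ∈ F, p.IsParabolic) : IsParabolicRegion {x | ∀ p ∈ F, p.eval x ≤ 0} := by
  have := hF.to_subtype
  obtain ⟨n, ⟨e⟩⟩ := Finite.exists_equiv_fin F
  refine ⟨n, fun i => (e.symm i : QuadPoly), fun i => hp _ (e.symm i).2, ?_⟩
  ext x
  refine ⟨fun h i => h _ (e.symm i).2, fun h p hpF => ?_⟩
  have := h (e ⟨p, hpF⟩)
  simpa using this

namespace QuadPoly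

theorem IsParabolic.neg {p : QuadPoly} (h : p.IsParabolic) : p.neg.IsParabolic := by
  refine ⟨fun h' => h.1 (by simpa [QuadPoly.neg] using h'), ?_⟩
  have := h.2
  simp only [QuadPoly.neg]
  linarith

theorem IsDegenerate.isParabolic_or_eval {p : QuadPoly} (h : p.IsDegenerate) :
    p.IsParabolic ∨ ∀ s, p.eval s = 0 := by
  by_cases h0 : p.a = 0 ∧ p.b = 0 ∧ p.c = 0 ∧ p.d = 0 ∧ p.e = 0 ∧ p.f = 0
  · obtain ⟨h1, h2, h3, h4, h5, h6⟩ := h0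
    exact Or.inr fun s => by simp [eval, h1, h2, h3, h4, h5, h6]
  · exact Or.inl ⟨h0, h⟩

end QuadPoly

/-- Each assignment of weak signs to the polynomials of `L` cuts out a coherent cell of the domain.
Two different assignments disagree on some polynomial, whose zero set is a parabola containing the
intersection of the cells. -/
theorem isPiecewiseQuadratic_conjugate {q : QuadPoly} {P : Set (ℝ × ℝ)} (hne : P.Nonempty)
    (h : q.PiecewiseSup (fun _ => True) P) :
    IsPiecewiseQuadraticOnParabolicSubdivision (conjugate (restrictTo q.eval P)) := by
  obtain ⟨D, L, T, hD, hL, -, hDd, hLd, -, hdom, hsup⟩ := h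
  have heff : effDom (conjugate (restrictTo q.eval P)) = {s | BddAbove (q.payoff s '' P)} :=
    ext fun s => conjugate_restrictTo_lt_top_iff hne
  -- Only the zero polynomial is degenerate without being parabolic; it imposes no condition and is
  -- discarded.
  let D' : Set QuadPoly := {p ∈ D | p.IsParabolic}
  let L' : Set QuadPoly := {p ∈ L | p.IsParabolic}
  have hL'fin : L'.Finite := hL.subset fun p hp => hp.1
  have hD' : ∀ s, (∀ p ∈ D', p.eval s ≤ 0) ↔ BddAbove (q.payoff s '' P) := by
    intro s
    rw [hdom]
    refine ⟨fun h p hp => ?_, fun h p hp => h p hp.1⟩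
    rcases (hDd p hp).isParabolic_or_eval with h' | h'
    · exact h p ⟨hp, h'⟩
    · exact (h' s).le
  have := hL'fin.to_subtype
  let signed (σ : L' → Bool) (p : L') : QuadPoly := if σ p then (p : QuadPoly) else (p : QuadPoly).neg
  let cell (σ : L' → Bool) : Set (ℝ × ℝ) :=
    {s | ∀ p ∈ D' ∪ range (signed σ), p.eval s ≤ 0}
  have cell_dom : ∀ σ, ∀ s ∈ cell σ, BddAbove (q.payoff s '' P) := fun σ s hs =>
    (hD' s).1 fun p hp => hs p (Or.inl hp)
  have cell_true : ∀ σ, ∀ p : L', σ p = true → ∀ s ∈ cell σ, (p : QuadPoly).eval s ≤ 0 := by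
    intro σ p hσ s hs
    simpa [signed, hσ] using hs _ (Or.inr ⟨p, rfl⟩)
  have cell_false : ∀ σ, ∀ p : L', σ p = false → ∀ s ∈ cell σ, 0 ≤ (p : QuadPoly).eval s := by
    intro σ p hσ s hs
    simpa [signed, hσ, QuadPoly.neg_eval] using hs _ (Or.inr ⟨p, rfl⟩)
  have cell_coherent : ∀ σ, Coherent L (cell σ) := by
    intro σ p hp
    rcases (hLd p hp).isParabolic_or_eval with h' | h'
    · cases hσ : σ ⟨p, hp, h'⟩ with
      | true => exact Or.inl (cell_true σ _ hσ)
      | false => exact Or.inr (cell_false σ _ hσ)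
    · exact Or.inl fun s _ => (h' s).le
  have cell_region : ∀ σ, IsParabolicRegion (cell σ) := by
    intro σ
    refine isParabolicRegion_of_finite ((hD.subset fun p hp => hp.1).union (finite_range _)) ?_
    rintro _ (hp | ⟨p, rfl⟩)
    · exact hp.2
    · simp only [signed]
      split_ifs
      exacts [p.2.2, p.2.2.neg]
  have cell_inter : ∀ σ τ, σ ≠ τ → ∃ S, IsParabola S ∧ cell σ ∩ cell τ ⊆ S := by
    intro σ τ hστ
    obtain ⟨p, hp⟩ := Function.ne_iff.1 hστ
    refine ⟨_, ⟨p, p.2.2, rfl⟩, fun s hs => ?_⟩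
    cases h1 : σ p with
    | true =>
      have h2 : τ p = false := by simpa [h1] using hp.symm
      exact le_antisymm (cell_true σ p h1 s hs.1) (cell_false τ p h2 s hs.2)
    | false =>
      have h2 : τ p = true := by simpa [h1] using hp.symm
      exact le_antisymm (cell_true τ p h2 s hs.2) (cell_false σ p h1 s hs.1)
  choose g _ hg using fun σ => hsup (cell σ) (cell_coherent σ) (cell_dom σ)
  obtain ⟨n, ⟨e⟩⟩ := Finite.exists_equiv_fin (L' → Bool)
  refine ⟨n, fun k => cell (e.symm k), fun k => g (e.symm k), ⟨?_, ?_, fun k => cell_region _, ?_⟩,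
    fun k s hs => conjugate_restrictTo_of_isLUB (hg _ s hs)⟩
  · rw [heff]
    exact q.convex_bddAbove_payoff P
  · rw [heff]
    ext s
    simp only [mem_iUnion]
    constructor
    · intro hs
      classical
      refine ⟨e fun p => decide ((p : QuadPoly).eval s ≤ 0), ?_⟩
      rw [e.symm_apply_apply]
      rintro _ (hp | ⟨p, rfl⟩)
      · exact (hD' s).2 hs _ hp
      · simp only [signed, decide_eq_true_eq]
        split_ifs with h
        · exact h
        · rw [QuadPoly.neg_eval]
          linarith
    · rintro ⟨k, hk⟩
      exact cell_dom _ s hk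
  · exact fun j k hjk => Or.inr (cell_inter _ _ (e.symm.injective.ne hjk))

theorem mainTheorem4 (q : QuadPoly) (P : Set (ℝ × ℝ)) (hP : IsPolyhedralSet P)
    (hne : P.Nonempty) :
    (∀ (n : ℕ) (r : Fin n → ℝ × ℝ → ℝ) (R : Fin n → Set (ℝ × ℝ)),
      IsMinOfPieces (convEnvelope (restrictTo q.eval P)) r R →
        IsPiecewiseQuadraticOnParabolicSubdivision
          (fun s => ⨆ j, conjugate (restrictTo (r j) (R j)) s)) ∧
    IsPiecewiseQuadraticOnParabolicSubdivision
      (conjugate (convEnvelope (restrictTo q.eval P))) := by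
  have main : IsPiecewiseQuadraticOnParabolicSubdivision
      (conjugate (convEnvelope (restrictTo q.eval P))) := by
    obtain ⟨x₀, hx₀⟩ := hne
    rw [conjugate_convEnvelope (x₀ := x₀) (by simp [restrictTo, indicatorFn, hx₀])]
    exact isPiecewiseQuadratic_conjugate ⟨x₀, hx₀⟩ (QuadPoly.exists_piecewiseSup hP ⟨x₀, hx₀⟩)
  refine ⟨fun n r R h => ?_, main⟩
  rw [conjugate_eq_iSup_of_isMinOfPieces h]
  exact main
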